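/- Let $M$ be a real smooth $5$-dimensional manifold endowed with a Lorentzian metric $g$ of signature $(-\,+\,+\,+\,+)$, let $R$ be a real symmetric bilinear form on $T_p(M)$ at a point $p\in M$, and let $R^a{}_b$ be its mixed form, i.e. the linear operator on $T_p(M)$ with $g(R^a{}_b v,w)=R(v,w)$ for all $v,w$. A null vector is a vector $v\neq 0$ with $g(v,v)=0$. A subspace of $T_p(M)$ is called time-like if it contains two linearly independent null vectors, null if it contains a null vector and all its null vectors are proportional, and (if its dimension is at least $2$) space-like if it contains no null vector. Then: (i) There always exists a $2$-dimensional space-like subspace of $T_p(M)$ invariant under $R^a{}_b$. (ii) If a non-null subspace $\mathcal V$ of $T_p(M)$ is invariant under $R^a{}_b$, then so is its orthogonal complement $\mathcal V^{\perp}$. (iii) There always exists a $3$-dimensional time-like subspace of $T_p(M)$ invariant under $R^a{}_b$. (iv) For each $r\in\{2,3,4\}$, $R^a{}_b$ admits an $r$-dimensional null invariant subspace of $T_p(M)$ if and only if it has a null eigenvector (a null vector $k\in T_p(M)$ with $R^a{}_b k=\mu k$ for some real $\mu$). More precisely, every $r$-dimensional null invariant subspace $\mathcal N$ contains a null eigenvector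 of $R^a{}_b$, and every null eigenvector of $R^a{}_b$ lies in some $r$-dimensional null invariant subspace $\mathcal N$. -/

import Mathlib

open scoped Manifold ContDiff Bundle

section LinearAlgebra

variable {V : Type*} [AddCommGroup V] [Module ℝ V]

/-- The bilinear form `g` on a five-dimensional real vector space is a Lorentzian inner product of
signature `(- + + + +)`: there is a Lorentz pentad, i.e. a basis `t, w, x, y, z` whose only
non-zero inner products are `-g t t = g w w = g x x = g y y = g z z = 1`. -/
def IsLorentzian (g : LinearMap.BilinForm ℝ V) : Prop :=
  ∃ e : Module.Basis (Fin 5) ℝ V,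
    ∀ i j, g (e i) (e j) = if i = j then (if i = 0 then -1 else 1) else 0

theorem IsLorentzian.finiteDimensional {g : LinearMap.BilinForm ℝ V} (hg : IsLorentzian g) :
    FiniteDimensional ℝ V := by
  obtain ⟨e, -⟩ := hg
  exact Module.Finite.of_basis e

theorem IsLorentzian.nondegenerate {g : LinearMap.BilinForm ℝ V} (hg : IsLorentzian g) :
    g.Nondegenerate := by
  obtain ⟨e, he⟩ := hg
  refine LinearMap.IsOrthoᵢ.nondegenerate_of_not_isOrtho_basis_self e ?_ ?_
  · intro i j hij
    exact (he i j).trans (if_neg hij)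
  · intro i hi
    have h : (if i = 0 then (-1 : ℝ) else 1) = 0 :=
      (if_pos rfl).symm.trans ((he i i).symm.trans hi)
    split_ifs at h <;> norm_num at h

/-- The mixed form `R^a_b = g^{ac} R_{cb}` of a covariant two-tensor `R`, i.e. the linear operator
with `g (R^a_b v) w = R v w`. -/
noncomputable def mixedForm (g R : LinearMap.BilinForm ℝ V) (hg : IsLorentzian g) :
    Module.End ℝ V :=
  haveI : FiniteDimensional ℝ V := hg.finiteDimensional
  LinearMap.BilinForm.symmCompOfNondegenerate R g hg.nondegenerate

/-- Characterization of the mixed form. -/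
theorem mixedForm_spec (g R : LinearMap.BilinForm ℝ V) (hg : IsLorentzian g) (v w : V) :
    g (mixedForm g R hg v) w = R v w := by
  have : FiniteDimensional ℝ V := hg.finiteDimensional
  exact LinearMap.BilinForm.symmCompOfNondegenerate_left_apply R hg.nondegenerate w v

/-- A continuous bilinear form, regarded as a bilinear form. -/
noncomputable def bilinFormOfContinuous [TopologicalSpace V] (B : V →L[ℝ] V →L[ℝ] ℝ) :
    LinearMap.BilinForm ℝ V :=
  LinearMap.mk₂ ℝ (fun v w => B v w) (by simp) (by simp) (by simp) (by simp)

/-- A null vector: non-zero and orthogonal to itself. -/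
def IsNullVector (g : LinearMap.BilinForm ℝ V) (v : V) : Prop :=
  v ≠ 0 ∧ g v v = 0

/-- A space-like subspace: of dimension at least two and without null vectors. -/
def IsSpacelikeSubspace (g : LinearMap.BilinForm ℝ V) (W : Submodule ℝ V) : Prop :=
  2 ≤ Module.finrank ℝ W ∧ ∀ v ∈ W, ¬ IsNullVector g v

/-- A null subspace: it contains exactly one independent null vector. (For a line this says that
it is spanned by a null vector.) -/
def IsNullSubspace (g : LinearMap.BilinForm ℝ V) (W : Submodule ℝ V) : Prop :=
  ∃ k ∈ W, IsNullVector g k ∧ ∀ v ∈ W, IsNullVector g v → ∃ c : ℝ, v = c • k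

/-- A time-like subspace: it contains more than one independent null vector. -/
def IsTimelikeSubspace (g : LinearMap.BilinForm ℝ V) (W : Submodule ℝ V) : Prop :=
  ∃ k ∈ W, ∃ n ∈ W, IsNullVector g k ∧ IsNullVector g n ∧ LinearIndependent ℝ ![k, n]

/-- The subspace `W` is invariant under the operator `T`. -/
def IsInvariantSubspace (T : Module.End ℝ V) (W : Submodule ℝ V) : Prop :=
  ∀ v ∈ W, T v ∈ W

/-- `k` is a null eigenvector of `T` (with some real eigenvalue). -/
def IsNullEigenvector (g : LinearMap.BilinForm ℝ V) (T : Module.End ℝ V) (k : V) : Prop :=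
  IsNullVector g k ∧ ∃ μ : ℝ, T k = μ • k

end LinearAlgebra

/-- A smooth Lorentzian metric of signature `(- + + + +)` on a five-dimensional smooth manifold. -/
structure LorentzianMetric (M : Type*) [TopologicalSpace M]
    [ChartedSpace (EuclideanSpace ℝ (Fin 5)) M] [IsManifold (𝓡 5) ∞ M] where
  /-- The inner product on each tangent space. -/
  inner (p : M) : TangentSpace (𝓡 5) p →L[ℝ] TangentSpace (𝓡 5) p →L[ℝ] ℝ
  /-- Each inner product has signature `(- + + + +)`; in particular it is symmetric. -/
  lorentzian (p : M) : IsLorentzian (bilinFormOfContinuous (inner p))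
  /-- The metric depends smoothly on the point. -/
  contMDiff : ContMDiff (𝓡 5)
    ((𝓡 5).prod 𝓘(ℝ, EuclideanSpace ℝ (Fin 5) →L[ℝ] EuclideanSpace ℝ (Fin 5) →L[ℝ] ℝ)) ∞
    (fun p => Bundle.TotalSpace.mk'
      (EuclideanSpace ℝ (Fin 5) →L[ℝ] EuclideanSpace ℝ (Fin 5) →L[ℝ] ℝ)
      (E := fun p : M => TangentSpace (𝓡 5) p →L[ℝ] TangentSpace (𝓡 5) p →L[ℝ] ℝ) p (inner p))

/-- The inner product of a Lorentzian metric at `p`, as a bilinear form on the tangent space. -/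
noncomputable def LorentzianMetric.formAt {M : Type*} [TopologicalSpace M]
    [ChartedSpace (EuclideanSpace ℝ (Fin 5)) M] [IsManifold (𝓡 5) ∞ M]
    (g : LorentzianMetric M) (p : M) : LinearMap.BilinForm ℝ (TangentSpace (𝓡 5) p) :=
  bilinFormOfContinuous (g.inner p)

/-- The mixed form `R^a_b` at `p` of a two-tensor `R` at `p`, as an operator on the tangent
space. -/
noncomputable def LorentzianMetric.mixed {M : Type*} [TopologicalSpace M]
    [ChartedSpace (EuclideanSpace ℝ (Fin 5)) M] [IsManifold (𝓡 5) ∞ M]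
    (g : LorentzianMetric M) (p : M) (R : LinearMap.BilinForm ℝ (TangentSpace (𝓡 5) p)) :
    Module.End ℝ (TangentSpace (𝓡 5) p) :=
  mixedForm (g.formAt p) R (g.lorentzian p)

/-! ### Invariant subspaces and eigenvectors modulo a subspace. -/

section InvariantSubspaces

variable {V : Type*} [AddCommGroup V] [Module ℝ V]

/-! Symmetry of `R` makes `T = R^a_b` self-adjoint for `g`, so orthogonal complements of invariant
subspaces are invariant; this is (ii). For (i) and (iii) it suffices to find two orthogonal
space-like eigenvectors (`IsLorentzian.hasSpacelikeEigenpair`): their span is the plane, its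
complement the time-like 3-space. A time-like eigenvector or a complex eigenpair gives an invariant
subspace of dimension at most 2 containing a time-like vector; its complement is positive definite,
and the spectral theorem applies. For a null eigenvector `k` the form on `k⊥/k` is positive
definite, and eigenvectors modulo `k` are corrected to true ones. Otherwise an eigenvector `e` is
space-like, and the argument is repeated in `e⊥`. For (iv), the null line of a null subspace is its
radical, which `T` preserves. Conversely, an eigenvector `u` of `T` on `k⊥/k` gives the null
subspaces `span{k,u}`, its complement, and `k⊥`. -/

theorem IsInvariantSubspace.aeval_mem {T : Module.End ℝ V} {W : Submodule ℝ V}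
    (hW : IsInvariantSubspace T W) (p : Polynomial ℝ) {v : V} (hv : v ∈ W) :
    Polynomial.aeval T p v ∈ W := by
  induction p using Polynomial.induction_on' with
  | add p q hp hq => simpa using W.add_mem hp hq
  | monomial n a =>
    have h : (T ^ n) v ∈ W := by
      induction n with
      | zero => simpa using hv
      | succ n ih => rw [pow_succ', Module.End.mul_apply]; exact hW _ ih
    rw [Polynomial.aeval_monomial]
    simpa using W.smul_mem a h

theorem Irreducible.exists_root_or_quadratic {q : Polynomial ℝ} (hq : Irreducible q) :
    (∃ l, q.IsRoot l) ∨ ∃ c a d : ℝ, c ≠ 0 ∧ 0 < d ∧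
      q = Polynomial.C c * ((Polynomial.X - Polynomial.C a) ^ 2 + Polynomial.C d) := by
  have hform := Polynomial.eq_quadratic_of_degree_le_two hq.degree_le_two
  set c := q.coeff 2
  set b := q.coeff 1
  set e := q.coeff 0
  have heval (x : ℝ) : q.eval x = c * (x * x) + b * x + e := by
    rw [hform]
    simp [pow_two]
  by_cases hc : c = 0
  · left
    by_cases hb : b = 0
    · exfalso
      apply hq.not_isUnit
      have he : q = Polynomial.C e := by rw [hform, hc, hb]; simp
      have he0 : e ≠ 0 := by
        intro h0
        apply hq.ne_zero
        rw [he, h0, Polynomial.C_0]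
      rw [he]
      exact Polynomial.isUnit_C.2 he0.isUnit
    · refine ⟨-e / b, ?_⟩
      rw [Polynomial.IsRoot, heval, hc]
      field_simp
      ring
  · by_cases hd : 0 ≤ discrim c b e
    · left
      obtain ⟨x, hx⟩ := exists_quadratic_eq_zero hc ⟨_, (Real.mul_self_sqrt hd).symm⟩
      exact ⟨x, by rw [Polynomial.IsRoot, heval, hx]⟩
    · right
      -- Completing the square: the complex roots are `a ± i√d`.
      refine ⟨c, -b / (2 * c), -discrim c b e / (4 * c ^ 2), hc, ?_, ?_⟩
      · have : 0 < c ^ 2 := by positivity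
        push Not at hd
        apply div_pos <;> linarith
      · apply Polynomial.funext
        intro x
        rw [heval]
        simp [discrim]
        field_simp
        ring

/-- If `A ⊂ B` are invariant subspaces then `T` has, modulo `A`, an eigenvector in `B`, or the
real part `u` of a complex eigenvector. -/
theorem exists_eigenvector_or_quadratic_mod [FiniteDimensional ℝ V] {T : Module.End ℝ V}
    {A B : Submodule ℝ V} (hA : IsInvariantSubspace T A) (hB : IsInvariantSubspace T B)
    (hAB : ¬ B ≤ A) :
    ∃ u ∈ B, u ∉ A ∧ ((∃ l : ℝ, T u - l • u ∈ A) ∨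
      ∃ (a d : ℝ) (w : V), 0 < d ∧ w ∈ B ∧ T u = a • u + w ∧ T w - a • w + d • u ∈ A) := by
  have key (p : Polynomial ℝ) (hp : p ≠ 0) : ∀ v ∈ B, v ∉ A → Polynomial.aeval T p v ∈ A →
      ∃ u ∈ B, u ∉ A ∧ ((∃ l : ℝ, T u - l • u ∈ A) ∨
      ∃ (a d : ℝ) (w : V), 0 < d ∧ w ∈ B ∧ T u = a • u + w ∧ T w - a • w + d • u ∈ A) := by
    induction p using WfDvdMonoid.induction_on_irreducible with
    | zero => exact absurd rfl hp
    | unit p hu =>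
      intro v hvB hvA hv
      obtain ⟨q, hq⟩ := hu.exists_left_inv
      have := hA.aeval_mem q hv
      rw [← Module.End.mul_apply, ← map_mul, hq, map_one] at this
      exact absurd this hvA
    | mul p q hp0 hq ih =>
      intro v hvB hvA hv
      -- Irreducible factors are peeled off an annihilator of `v` modulo `A`; at the factor `q`
      -- where membership in `A` first fails, `u = p(T) v` satisfies `q(T) u ∈ A` but `u ∉ A`.
      by_cases hw : Polynomial.aeval T p v ∈ A
      · exact ih hp0 v hvB hvA hw
      have huB := hB.aeval_mem p hvB
      rw [map_mul, Module.End.mul_apply] at hv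
      set u := Polynomial.aeval T p v
      refine ⟨u, huB, hw, ?_⟩
      rcases hq.exists_root_or_quadratic with ⟨l, hl⟩ | ⟨c, a, d, hc, hd, rfl⟩
      · left
        refine ⟨l, ?_⟩
        have hdvd : q ∣ Polynomial.X - Polynomial.C l :=
          ((Polynomial.irreducible_X_sub_C l).dvd_comm hq).1 (Polynomial.dvd_iff_isRoot.2 hl)
        obtain ⟨s, hs⟩ := hdvd
        have := hA.aeval_mem s hv
        rw [← Module.End.mul_apply, ← map_mul, mul_comm, ← hs] at this
        simpa [Module.algebraMap_end_apply] using this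
      · right
        refine ⟨a, d, T u - a • u, hd, B.sub_mem (hB _ huB) (B.smul_mem _ huB), by abel, ?_⟩
        have := A.smul_mem c⁻¹ hv
        simpa [Module.algebraMap_end_apply, pow_two, hc] using this
  obtain ⟨v, hvB, hvA⟩ := SetLike.not_le_iff_exists.1 hAB
  exact key T.charpoly T.charpoly_monic.ne_zero v hvB hvA (by
    rw [LinearMap.aeval_self_charpoly]; simp)

theorem IsInvariantSubspace.inf {T : Module.End ℝ V} {A B : Submodule ℝ V}
    (hA : IsInvariantSubspace T A) (hB : IsInvariantSubspace T B) :
    IsInvariantSubspace T (A ⊓ B) := fun v hv => ⟨hA v hv.1, hB v hv.2⟩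

theorem isInvariantSubspace_bot (T : Module.End ℝ V) : IsInvariantSubspace T ⊥ := by
  intro v hv
  rw [Submodule.mem_bot] at hv ⊢
  rw [hv, map_zero]

theorem isInvariantSubspace_span {T : Module.End ℝ V} {s : Set V}
    (h : ∀ v ∈ s, T v ∈ Submodule.span ℝ s) : IsInvariantSubspace T (Submodule.span ℝ s) := by
  intro v hv
  have : Submodule.span ℝ s ≤ (Submodule.span ℝ s).comap T := Submodule.span_le.2 h
  exact this hv

theorem isInvariantSubspace_span_singleton {T : Module.End ℝ V} {k : V} {m : ℝ}
    (h : T k = m • k) : IsInvariantSubspace T (Submodule.span ℝ {k}) := by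
  apply isInvariantSubspace_span
  rintro v rfl
  rw [h]
  exact Submodule.smul_mem _ _ (Submodule.mem_span_singleton_self _)

theorem isInvariantSubspace_orthogonal {g : LinearMap.BilinForm ℝ V} {T : Module.End ℝ V}
    (hT : ∀ v w, g (T v) w = g v (T w)) {W : Submodule ℝ V} (hW : IsInvariantSubspace T W) :
    IsInvariantSubspace T (g.orthogonal W) := by
  intro v hv w hw
  exact (hT w v).symm.trans (hv _ (hW w hw))

theorem mem_orthogonal_span_singleton {g : LinearMap.BilinForm ℝ V} {v w : V} :
    w ∈ g.orthogonal (Submodule.span ℝ {v}) ↔ g v w = 0 := by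
  rw [LinearMap.BilinForm.mem_orthogonal_iff]
  constructor
  · intro h; exact h v (Submodule.mem_span_singleton_self v)
  · intro h x hx
    obtain ⟨c, rfl⟩ := Submodule.mem_span_singleton.1 hx
    simp [h]

theorem finrank_span_singleton_le_one (v : V) : Module.finrank ℝ (Submodule.span ℝ {v}) ≤ 1 := by
  simpa using finrank_span_le_card (R := ℝ) ({v} : Set V)

theorem finrank_le_finrank_inf_orthogonal_add_one [FiniteDimensional ℝ V]
    (g : LinearMap.BilinForm ℝ V) (B : Submodule ℝ V) (v : V) :
    Module.finrank ℝ B ≤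
      Module.finrank ℝ (B ⊓ g.orthogonal (Submodule.span ℝ {v}) : Submodule ℝ V) + 1 := by
  have h1 := Submodule.finrank_sup_add_finrank_inf_eq B (g.orthogonal (Submodule.span ℝ {v}))
  have h2 := LinearMap.BilinForm.finrank_add_finrank_orthogonal' (B := g) (Submodule.span ℝ {v})
  have h3 := Submodule.finrank_le (B ⊔ g.orthogonal (Submodule.span ℝ {v}))
  have h4 := finrank_span_singleton_le_one v
  omega

theorem finrank_span_pair {v w : V} (h : LinearIndependent ℝ ![v, w]) :
    Module.finrank ℝ (Submodule.span ℝ {v, w}) = 2 := by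
  have := finrank_span_eq_card h
  rwa [Matrix.range_cons_cons_empty, Fintype.card_fin] at this

theorem not_le_of_finrank_lt [FiniteDimensional ℝ V] {A B : Submodule ℝ V}
    (h : Module.finrank ℝ A < Module.finrank ℝ B) : ¬ B ≤ A :=
  fun hle => absurd (Submodule.finrank_mono hle) (by omega)

end InvariantSubspaces

/-! ### Self-adjoint operators on semidefinite subspaces. -/

section SelfAdjoint

variable {V : Type*} [AddCommGroup V] [Module ℝ V]

/-- A self-adjoint operator has an eigenvector modulo the radical on an invariant subspace on
which the form is positive semidefinite. -/
theorem exists_eigenvector_mod_of_semidefinite [FiniteDimensional ℝ V]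
    {g : LinearMap.BilinForm ℝ V} {T : Module.End ℝ V} (hT : ∀ v w, g (T v) w = g v (T w))
    {A B : Submodule ℝ V} (hA : IsInvariantSubspace T A) (hB : IsInvariantSubspace T B)
    (hAB : ¬ B ≤ A) (hnonneg : ∀ v ∈ B, 0 ≤ g v v) (hpos : ∀ v ∈ B, v ∉ A → 0 < g v v)
    (hrad : ∀ v ∈ B, ∀ a ∈ A, g v a = 0) :
    ∃ u ∈ B, u ∉ A ∧ ∃ l : ℝ, T u - l • u ∈ A := by
  obtain ⟨u, huB, huA, h | ⟨a, d, w, hd, hwB, hu, hw⟩⟩ :=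
    exists_eigenvector_or_quadratic_mod hA hB hAB
  · exact ⟨u, huB, huA, h⟩
  · exfalso
    -- Pairing the quadratic relation with `u` gives `g w w + d * g u u = 0`, which semidefiniteness
    -- forbids.
    have h1 := hrad u huB _ hw
    rw [map_add, map_sub, ← hT, hu] at h1
    simp only [map_add, map_smul, LinearMap.add_apply, LinearMap.smul_apply, smul_eq_mul] at h1
    have h2 := hnonneg w hwB
    have h3 := mul_pos hd (hpos u huB huA)
    linarith

/-- An eigenvector of positive square. -/
def IsSpacelikeEigenvector (g : LinearMap.BilinForm ℝ V) (T : Module.End ℝ V) (f : V) : Prop :=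
  0 < g f f ∧ ∃ n : ℝ, T f = n • f

/-- There are two orthogonal space-like eigenvectors. -/
def HasSpacelikeEigenpair (g : LinearMap.BilinForm ℝ V) (T : Module.End ℝ V) : Prop :=
  ∃ e f, IsSpacelikeEigenvector g T e ∧ IsSpacelikeEigenvector g T f ∧ g e f = 0

/-- Two steps of the spectral theorem: an eigenvector `e` in `B`, then another in `B ∩ e⊥`. -/
theorem HasSpacelikeEigenpair.of_posDef [FiniteDimensional ℝ V]
    {g : LinearMap.BilinForm ℝ V} {T : Module.End ℝ V} (hT : ∀ v w, g (T v) w = g v (T w))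
    {B : Submodule ℝ V} (hB : IsInvariantSubspace T B) (hpos : ∀ v ∈ B, v ≠ 0 → 0 < g v v)
    (hdim : 2 ≤ Module.finrank ℝ B) : HasSpacelikeEigenpair g T := by
  have step (C : Submodule ℝ V) (hC : IsInvariantSubspace T C) (hCB : C ≤ B)
      (hCd : 1 ≤ Module.finrank ℝ C) : ∃ u ∈ C, IsSpacelikeEigenvector g T u := by
    obtain ⟨u, huC, hu0, l, hl⟩ := exists_eigenvector_mod_of_semidefinite hT
      (isInvariantSubspace_bot T) hC (not_le_of_finrank_lt (by rw [finrank_bot]; omega))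
      (fun v hv => by
        by_cases h : v = 0
        · simp [h]
        · exact (hpos v (hCB hv) h).le)
      (fun v hv h => hpos v (hCB hv) (by simpa using h))
      (fun v _ a ha => by rw [(Submodule.mem_bot ℝ).1 ha, map_zero])
    exact ⟨u, huC, hpos u (hCB huC) (by simpa using hu0), l,
      sub_eq_zero.1 ((Submodule.mem_bot ℝ).1 hl)⟩
  obtain ⟨e, heB, he⟩ := step B hB le_rfl (by omega)
  have hd := finrank_le_finrank_inf_orthogonal_add_one g B e
  obtain ⟨m, hm⟩ := he.2
  obtain ⟨f, hfB, hf⟩ := step (B ⊓ g.orthogonal (Submodule.span ℝ {e}))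
    (hB.inf (isInvariantSubspace_orthogonal hT (isInvariantSubspace_span_singleton hm)))
    inf_le_left (by omega)
  exact ⟨e, f, he, hf, mem_orthogonal_span_singleton.1 hfB.2⟩

end SelfAdjoint

/-! ### Causal geometry, null eigenvectors and space-like eigenpairs. -/

section Lorentzian

variable {V : Type*} [AddCommGroup V] [Module ℝ V] {g : LinearMap.BilinForm ℝ V}

theorem IsLorentzian.finrank_eq (hg : IsLorentzian g) : Module.finrank ℝ V = 5 := by
  obtain ⟨e, -⟩ := hg
  simp [Module.finrank_eq_card_basis e]

theorem IsLorentzian.exists_coordinates (hg : IsLorentzian g) :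
    ∃ e : Module.Basis (Fin 5) ℝ V, ∀ v w, g v w = -(e.repr v 0 * e.repr w 0) +
      e.repr v 1 * e.repr w 1 + e.repr v 2 * e.repr w 2 + e.repr v 3 * e.repr w 3 +
      e.repr v 4 * e.repr w 4 := by
  obtain ⟨e, he⟩ := hg
  refine ⟨e, fun v w => ?_⟩
  conv_lhs => rw [← e.sum_repr v, ← e.sum_repr w]
  simp [-Module.Basis.sum_repr, Fin.sum_univ_five, he]

theorem IsLorentzian.symm (hg : IsLorentzian g) (v w : V) : g v w = g w v := by
  obtain ⟨e, he⟩ := hg.exists_coordinates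
  rw [he, he]
  ring

theorem IsLorentzian.exists_timelike (hg : IsLorentzian g) : ∃ t, g t t < 0 := by
  obtain ⟨e, he⟩ := hg
  exact ⟨e 0, by rw [he]; simp⟩

/-- A vector orthogonal to a causal vector `t` is space-like or null, and it is null only if it
is a multiple of `t`. -/
theorem IsLorentzian.nonneg_of_orthogonal_causal (hg : IsLorentzian g) {t v : V} (ht0 : t ≠ 0)
    (ht : g t t ≤ 0) (h : g t v = 0) :
    0 ≤ g v v ∧ (g v v = 0 → v ∈ Submodule.span ℝ {t}) := by
  obtain ⟨e, he⟩ := hg.exists_coordinates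
  -- Both sides are the square of `t₀ v - v₀ t`: the cross term vanishes by orthogonality, and the
  -- vector has no time component, so its square is Euclidean.
  have hid : e.repr t 0 ^ 2 * g v v + e.repr v 0 ^ 2 * g t t =
      (e.repr t 0 * e.repr v 1 - e.repr v 0 * e.repr t 1) ^ 2 +
      (e.repr t 0 * e.repr v 2 - e.repr v 0 * e.repr t 2) ^ 2 +
      (e.repr t 0 * e.repr v 3 - e.repr v 0 * e.repr t 3) ^ 2 +
      (e.repr t 0 * e.repr v 4 - e.repr v 0 * e.repr t 4) ^ 2 := by
    rw [he] at h ⊢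
    rw [he]
    linear_combination 2 * e.repr t 0 * e.repr v 0 * h
  have ht1 : e.repr t 0 ≠ 0 := by
    intro h0
    apply ht0
    rw [he, h0] at ht
    obtain ⟨h1, h2, h3, h4⟩ : e.repr t 1 = 0 ∧ e.repr t 2 = 0 ∧ e.repr t 3 = 0 ∧
        e.repr t 4 = 0 := by
      refine ⟨?_, ?_, ?_, ?_⟩ <;>
        nlinarith only [ht, sq_nonneg (e.repr t 1), sq_nonneg (e.repr t 2),
          sq_nonneg (e.repr t 3), sq_nonneg (e.repr t 4)]
    apply e.ext_elem
    intro i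
    fin_cases i <;> simp [h0, h1, h2, h3, h4]
  have hpos : 0 < e.repr t 0 ^ 2 := by positivity
  have hle : e.repr v 0 ^ 2 * g t t ≤ 0 := mul_nonpos_of_nonneg_of_nonpos (sq_nonneg _) ht
  refine ⟨?_, fun hv => ?_⟩
  · by_contra hneg
    push Not at hneg
    have := mul_neg_of_pos_of_neg hpos hneg
    nlinarith only [hid, hle, this, sq_nonneg (e.repr t 0 * e.repr v 1 - e.repr v 0 * e.repr t 1),
      sq_nonneg (e.repr t 0 * e.repr v 2 - e.repr v 0 * e.repr t 2),
      sq_nonneg (e.repr t 0 * e.repr v 3 - e.repr v 0 * e.repr t 3),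
      sq_nonneg (e.repr t 0 * e.repr v 4 - e.repr v 0 * e.repr t 4)]
  · rw [hv, mul_zero, zero_add] at hid
    rw [hid] at hle
    have hi : ∀ i, e.repr t 0 * e.repr v i - e.repr v 0 * e.repr t i = 0 := by
      intro i
      fin_cases i
      · simp [mul_comm]
      all_goals
        apply pow_eq_zero_iff two_ne_zero |>.1
        apply le_antisymm _ (sq_nonneg _)
        simp only [Fin.reduceFinMk, Fin.mk_one]
        linarith only [hle, sq_nonneg (e.repr t 0 * e.repr v 1 - e.repr v 0 * e.repr t 1),
          sq_nonneg (e.repr t 0 * e.repr v 2 - e.repr v 0 * e.repr t 2),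
          sq_nonneg (e.repr t 0 * e.repr v 3 - e.repr v 0 * e.repr t 3),
          sq_nonneg (e.repr t 0 * e.repr v 4 - e.repr v 0 * e.repr t 4)]
    rw [Submodule.mem_span_singleton]
    refine ⟨e.repr v 0 / e.repr t 0, e.ext_elem fun i => ?_⟩
    rw [map_smul, Finsupp.smul_apply, smul_eq_mul]
    field_simp
    linarith [hi i]

theorem IsLorentzian.pos_of_orthogonal_timelike (hg : IsLorentzian g) {t v : V} (ht : g t t < 0)
    (h : g t v = 0) (hv : v ≠ 0) : 0 < g v v := by
  have ht0 : t ≠ 0 := by rintro rfl; simp at ht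
  obtain ⟨h1, h2⟩ := hg.nonneg_of_orthogonal_causal ht0 ht.le h
  refine h1.lt_of_ne fun h3 => ?_
  obtain ⟨c, rfl⟩ := Submodule.mem_span_singleton.1 (h2 h3.symm)
  rw [map_smul, smul_eq_mul, mul_eq_zero] at h
  rcases h with h | h
  · exact hv (by rw [h, zero_smul])
  · exact ht.ne h

theorem IsLorentzian.pos_of_orthogonal_null (hg : IsLorentzian g) {k v : V}
    (hk : IsNullVector g k) (h : g k v = 0) (hv : v ∉ Submodule.span ℝ {k}) : 0 < g v v := by
  obtain ⟨h1, h2⟩ := hg.nonneg_of_orthogonal_causal hk.1 hk.2.le h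
  exact h1.lt_of_ne fun h3 => hv (h2 h3.symm)

/-- A subspace of `k⊥` containing the null vector `k` is null. -/
theorem IsLorentzian.isNullSubspace (hg : IsLorentzian g) {k : V} (hk : IsNullVector g k)
    {N : Submodule ℝ V} (hkN : k ∈ N) (hN : ∀ v ∈ N, g k v = 0) : IsNullSubspace g N := by
  refine ⟨k, hkN, hk, fun v hv hvn => ?_⟩
  obtain ⟨c, hc⟩ := Submodule.mem_span_singleton.1
    ((hg.nonneg_of_orthogonal_causal hk.1 hk.2.le (hN v hv)).2 hvn.2)
  exact ⟨c, hc.symm⟩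

/-- The null direction of a null subspace is its radical. -/
theorem IsLorentzian.orthogonal_of_isNullSubspace (hg : IsLorentzian g) {N : Submodule ℝ V}
    {k : V} (hkN : k ∈ N) (hk : IsNullVector g k)
    (hN : ∀ v ∈ N, IsNullVector g v → ∃ c : ℝ, v = c • k) {w : V} (hw : w ∈ N) : g k w = 0 := by
  by_contra h
  -- If `g k w ≠ 0`, the plane of `k` and `w` has a second null direction; the coefficient solves
  -- for it.
  have hz : g (w - (g w w / (2 * g k w)) • k) (w - (g w w / (2 * g k w)) • k) = 0 := by
    simp only [map_sub, map_smul, LinearMap.sub_apply, LinearMap.smul_apply, smul_eq_mul, hk.2,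
      hg.symm w k]
    field_simp
    ring
  have hmul : ∃ c : ℝ, w - (g w w / (2 * g k w)) • k = c • k := by
    by_cases h0 : w - (g w w / (2 * g k w)) • k = 0
    · exact ⟨0, by rw [h0, zero_smul]⟩
    · exact hN _ (N.sub_mem hw (N.smul_mem _ hkN)) ⟨h0, hz⟩
  obtain ⟨c, hc⟩ := hmul
  rw [sub_eq_iff_eq_add] at hc
  apply h
  rw [hc]
  simp [hk.2]

/-- An invariant null subspace contains a null eigenvector. -/
theorem IsLorentzian.exists_nullEigenvector_mem (hg : IsLorentzian g) {T : Module.End ℝ V}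
    (hT : ∀ v w, g (T v) w = g v (T w)) {N : Submodule ℝ V} (hN : IsNullSubspace g N)
    (hTN : IsInvariantSubspace T N) : ∃ k ∈ N, IsNullEigenvector g T k := by
  obtain ⟨k, hkN, hk, huniq⟩ := hN
  refine ⟨k, hkN, hk, ?_⟩
  have horth (w : V) (hw : w ∈ N) : g k w = 0 :=
    hg.orthogonal_of_isNullSubspace hkN hk huniq hw
  by_cases h0 : T k = 0
  · exact ⟨0, by rw [h0, zero_smul]⟩
  -- `T k` is null because `g (T k) (T k) = g k (T (T k))` and `T (T k)` lies in `N`, which is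
  -- orthogonal to `k`.
  · exact huniq _ (hTN k hkN) ⟨h0, by rw [hT]; exact horth _ (hTN _ (hTN k hkN))⟩

theorem IsLorentzian.exists_eigenvector_mod_null (hg : IsLorentzian g) {T : Module.End ℝ V}
    (hT : ∀ v w, g (T v) w = g v (T w)) {k : V} (hk : IsNullEigenvector g T k)
    {B : Submodule ℝ V} (hB : IsInvariantSubspace T B) (hBk : ∀ v ∈ B, g k v = 0)
    (hdim : 2 ≤ Module.finrank ℝ B) :
    ∃ u ∈ B, u ∉ Submodule.span ℝ {k} ∧ ∃ l a : ℝ, T u = l • u + a • k := by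
  have := hg.finiteDimensional
  obtain ⟨hk, m, hm⟩ := hk
  obtain ⟨u, huB, huk, l, hl⟩ := exists_eigenvector_mod_of_semidefinite hT
    (isInvariantSubspace_span_singleton hm) hB
    (not_le_of_finrank_lt ((finrank_span_singleton_le_one k).trans_lt hdim))
    (fun v hv => (hg.nonneg_of_orthogonal_causal hk.1 hk.2.le (hBk v hv)).1)
    (fun v hv hvk => hg.pos_of_orthogonal_null hk (hBk v hv) hvk)
    (fun v hv a ha => by
      obtain ⟨c, rfl⟩ := Submodule.mem_span_singleton.1 ha
      rw [map_smul, hg.symm, hBk v hv, smul_zero])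
  obtain ⟨a, ha⟩ := Submodule.mem_span_singleton.1 hl
  exact ⟨u, huB, huk, l, a, by rw [ha]; abel⟩

theorem linearIndependent_pair_of_notMem_span {k u : V} (hk : k ≠ 0)
    (hu : u ∉ Submodule.span ℝ {k}) : LinearIndependent ℝ ![k, u] := by
  rw [LinearIndependent.pair_iff' hk]
  rintro a rfl
  exact hu (Submodule.smul_mem _ _ (Submodule.mem_span_singleton_self _))

/-- A null eigenvector lies in invariant null subspaces of dimensions two, three and four. -/
theorem IsLorentzian.exists_nullSubspace (hg : IsLorentzian g) {T : Module.End ℝ V}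
    (hT : ∀ v w, g (T v) w = g v (T w)) {k : V} (hk : IsNullEigenvector g T k) {r : ℕ}
    (hr : r = 2 ∨ r = 3 ∨ r = 4) :
    ∃ N : Submodule ℝ V, Module.finrank ℝ N = r ∧ IsNullSubspace g N ∧
      IsInvariantSubspace T N ∧ k ∈ N := by
  have := hg.finiteDimensional
  obtain ⟨m, hm⟩ := hk.2
  have hkperp := isInvariantSubspace_orthogonal hT (isInvariantSubspace_span_singleton hm)
  have hkmem : k ∈ g.orthogonal (Submodule.span ℝ {k}) := mem_orthogonal_span_singleton.2 hk.1.2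
  have hdim : Module.finrank ℝ (g.orthogonal (Submodule.span ℝ {k})) = 4 := by
    rw [LinearMap.BilinForm.finrank_orthogonal hg.nondegenerate, hg.finrank_eq,
      finrank_span_singleton hk.1.1]
  obtain ⟨u, huB, huk, l, a, hu⟩ := hg.exists_eigenvector_mod_null hT hk hkperp
    (fun v hv => mem_orthogonal_span_singleton.1 hv) (by omega)
  have huk0 : g k u = 0 := mem_orthogonal_span_singleton.1 huB
  have hkP : k ∈ Submodule.span ℝ {k, u} := Submodule.subset_span (by simp)
  have huP : u ∈ Submodule.span ℝ {k, u} := Submodule.subset_span (by simp)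
  have hPrank := finrank_span_pair (linearIndependent_pair_of_notMem_span hk.1.1 huk)
  have hPinv : IsInvariantSubspace T (Submodule.span ℝ {k, u}) := by
    apply isInvariantSubspace_span
    rintro v (rfl | rfl)
    · rw [hm]; exact Submodule.smul_mem _ _ hkP
    · rw [hu]; exact Submodule.add_mem _ (Submodule.smul_mem _ _ huP) (Submodule.smul_mem _ _ hkP)
  have hPorth : ∀ v ∈ Submodule.span ℝ {k, u}, g k v = 0 := by
    intro v hv
    obtain ⟨b, c, rfl⟩ := Submodule.mem_span_pair.1 hv
    simp [hk.1.2, huk0]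
  rcases hr with rfl | rfl | rfl
  · exact ⟨_, hPrank, hg.isNullSubspace hk.1 hkP hPorth, hPinv, hkP⟩
  · have hkPo : k ∈ g.orthogonal (Submodule.span ℝ {k, u}) :=
      fun v hv => (hg.symm v k).trans (hPorth v hv)
    exact ⟨_, by
        rw [LinearMap.BilinForm.finrank_orthogonal hg.nondegenerate, hg.finrank_eq, hPrank],
      hg.isNullSubspace hk.1 hkPo fun v hv => hv k hkP,
      isInvariantSubspace_orthogonal hT hPinv, hkPo⟩
  · exact ⟨_, hdim, hg.isNullSubspace hk.1 hkmem fun v hv => mem_orthogonal_span_singleton.1 hv,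
      hkperp, hkmem⟩

/-- An eigenvector modulo `k` lifts to a true one unless its eigenvalue is that of `k`. In that
resonant case two orthogonal ones are combined to cancel the `k` terms; dimension 3 leaves room for
both modulo `k`. -/
theorem IsLorentzian.exists_spacelikeEigenvector_of_null (hg : IsLorentzian g)
    {T : Module.End ℝ V} (hT : ∀ v w, g (T v) w = g v (T w)) {k : V}
    (hk : IsNullEigenvector g T k) {B : Submodule ℝ V} (hB : IsInvariantSubspace T B)
    (hkB : k ∈ B) (hBk : ∀ v ∈ B, g k v = 0) (hdim : 3 ≤ Module.finrank ℝ B) :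
    ∃ f ∈ B, IsSpacelikeEigenvector g T f := by
  have := hg.finiteDimensional
  obtain ⟨m, hm⟩ := hk.2
  have corrected {u : V} {l a : ℝ} (huB : u ∈ B) (huk : u ∉ Submodule.span ℝ {k})
      (hu : T u = l • u + a • k) (hl : l ≠ m) : ∃ f ∈ B, IsSpacelikeEigenvector g T f := by
    -- The multiple of `k` absorbs `a • k`; it leaves the square unchanged since `u ⟂ k`.
    refine ⟨u + (a / (l - m)) • k, B.add_mem huB (B.smul_mem _ hkB), ?_, l, ?_⟩
    · have hpos := hg.pos_of_orthogonal_null hk.1 (hBk u huB) huk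
      simpa [hk.1.2, hBk u huB, hg.symm u k] using hpos
    · have hlm : l - m ≠ 0 := sub_ne_zero.2 hl
      rw [map_add, map_smul, hu, hm]
      match_scalars
      · rfl
      · field_simp
        ring
  obtain ⟨e, heB, hek, l, a, he⟩ := hg.exists_eigenvector_mod_null hT hk hB hBk (by omega)
  by_cases hl : l = m
  swap
  · exact corrected heB hek he hl
  subst hl
  have hepos := hg.pos_of_orthogonal_null hk.1 (hBk e heB) hek
  -- Although `e` is an eigenvector only modulo `k`, the error term is invisible because `B ⊆ k⊥`.
  have hinv : IsInvariantSubspace T (B ⊓ g.orthogonal (Submodule.span ℝ {e})) := by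
    intro v hv
    refine ⟨hB v hv.1, mem_orthogonal_span_singleton.2 ?_⟩
    rw [← hT, he]
    simp [hBk v hv.1, mem_orthogonal_span_singleton.1 hv.2]
  have hd := finrank_le_finrank_inf_orthogonal_add_one g B e
  obtain ⟨f, hfB, hfk, n, b, hf⟩ := hg.exists_eigenvector_mod_null hT hk hinv
    (fun v hv => hBk v hv.1) (by omega)
  by_cases hn : n = l
  swap
  · exact corrected hfB.1 hfk hf hn
  subst hn
  by_cases ha : a = 0
  · exact ⟨e, heB, hepos, n, by rw [he, ha, zero_smul, add_zero]⟩
  have hfpos := hg.pos_of_orthogonal_null hk.1 (hBk f hfB.1) hfk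
  have hef : g e f = 0 := mem_orthogonal_span_singleton.1 hfB.2
  refine ⟨b • e - a • f, B.sub_mem (B.smul_mem _ heB) (B.smul_mem _ hfB.1), ?_, n, ?_⟩
  · have : g (b • e - a • f) (b • e - a • f) = b ^ 2 * g e e + a ^ 2 * g f f := by
      simp [hef, hg.symm f e]
      ring
    rw [this]
    positivity
  · rw [map_sub, map_smul, map_smul, he, hf]
    module

theorem IsLorentzian.hasSpacelikeEigenpair_of_null (hg : IsLorentzian g)
    {T : Module.End ℝ V} (hT : ∀ v w, g (T v) w = g v (T w)) {k : V}
    (hk : IsNullEigenvector g T k) : HasSpacelikeEigenpair g T := by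
  have := hg.finiteDimensional
  obtain ⟨m, hm⟩ := hk.2
  have hkperp := isInvariantSubspace_orthogonal hT (isInvariantSubspace_span_singleton hm)
  have hkmem : k ∈ g.orthogonal (Submodule.span ℝ {k}) := mem_orthogonal_span_singleton.2 hk.1.2
  have hdim : Module.finrank ℝ (g.orthogonal (Submodule.span ℝ {k})) = 4 := by
    rw [LinearMap.BilinForm.finrank_orthogonal hg.nondegenerate, hg.finrank_eq,
      finrank_span_singleton hk.1.1]
  obtain ⟨e, heB, he⟩ := hg.exists_spacelikeEigenvector_of_null hT hk hkperp hkmem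
    (fun v hv => mem_orthogonal_span_singleton.1 hv) (by omega)
  obtain ⟨n, hn⟩ := he.2
  have hd := finrank_le_finrank_inf_orthogonal_add_one g (g.orthogonal (Submodule.span ℝ {k})) e
  obtain ⟨f, hfB, hf⟩ := hg.exists_spacelikeEigenvector_of_null hT hk
    (hkperp.inf (isInvariantSubspace_orthogonal hT (isInvariantSubspace_span_singleton hn)))
    ⟨hkmem, mem_orthogonal_span_singleton.2
      ((hg.symm e k).trans (mem_orthogonal_span_singleton.1 heB))⟩
    (fun v hv => mem_orthogonal_span_singleton.1 hv.1) (by omega)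
  exact ⟨e, f, he, hf, mem_orthogonal_span_singleton.1 hfB.2⟩

/-- `W⊥` is orthogonal to a time-like vector, hence positive definite, and has dimension at least 5
- 3 = 2. -/
theorem IsLorentzian.hasSpacelikeEigenpair_of_timelike_mem (hg : IsLorentzian g)
    {T : Module.End ℝ V} (hT : ∀ v w, g (T v) w = g v (T w)) {W : Submodule ℝ V}
    (hW : IsInvariantSubspace T W) (hdim : Module.finrank ℝ W ≤ 3) {t : V} (htW : t ∈ W)
    (ht : g t t < 0) : HasSpacelikeEigenpair g T := by
  have := hg.finiteDimensional
  refine HasSpacelikeEigenpair.of_posDef hT (isInvariantSubspace_orthogonal hT hW)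
    (fun v hv => hg.pos_of_orthogonal_timelike ht (hv t htW)) ?_
  rw [LinearMap.BilinForm.finrank_orthogonal hg.nondegenerate, hg.finrank_eq]
  omega

/-- The real and imaginary parts of a complex eigenvector span a time-like plane. -/
theorem IsLorentzian.exists_timelike_mem_span_of_quadratic (hg : IsLorentzian g)
    {T : Module.End ℝ V} (hT : ∀ v w, g (T v) w = g v (T w)) {u w : V} {a d : ℝ} (hu0 : u ≠ 0)
    (hd : 0 < d) (hu : T u = a • u + w) (hw : T w = a • w - d • u) :
    ∃ t ∈ Submodule.span ℝ {u, w}, g t t < 0 := by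
  have huP : u ∈ Submodule.span ℝ {u, w} := Submodule.subset_span (by simp)
  have hwP : w ∈ Submodule.span ℝ {u, w} := Submodule.subset_span (by simp)
  -- Self-adjointness on the pair `u`, `w` forces squares of opposite sign, so only the case where
  -- both vanish needs work.
  have hww : g w w = -(d * g u u) := by
    have := hT u w
    rw [hu, hw] at this
    simp at this
    linarith
  rcases lt_trichotomy (g u u) 0 with h | h | h
  · exact ⟨u, huP, h⟩
  · rw [h, mul_zero, neg_zero] at hww
    -- Orthogonal null vectors are proportional, which would make `u` an eigenvector with a real
    -- eigenvalue, against `0 < d`.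
    have huw : g u w ≠ 0 := by
      intro h0
      obtain ⟨c, rfl⟩ := Submodule.mem_span_singleton.1
        ((hg.nonneg_of_orthogonal_causal hu0 h.le h0).2 hww)
      rw [map_smul, hu] at hw
      have : (c ^ 2 + d) • u = 0 := by
        rw [← sub_eq_zero] at hw
        rw [← hw]
        module
      rcases smul_eq_zero.1 this with h1 | h1
      · nlinarith only [h1, hd, sq_nonneg c]
      · exact hu0 h1
    refine ⟨u - g u w • w, Submodule.sub_mem _ huP (Submodule.smul_mem _ _ hwP), ?_⟩
    have : g (u - g u w • w) (u - g u w • w) = -2 * g u w ^ 2 := by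
      simp [h, hww, hg.symm w u]
      ring
    rw [this]
    have : 0 < g u w ^ 2 := by positivity
    linarith
  · exact ⟨w, hwP, by rw [hww]; linarith [mul_pos hd h]⟩

/-- `step` either finishes through a time-like, null or complex eigenvector, or yields a space-like
one in `B`; it is run on the whole space and then on `e⊥`. -/
theorem IsLorentzian.hasSpacelikeEigenpair (hg : IsLorentzian g) {T : Module.End ℝ V}
    (hT : ∀ v w, g (T v) w = g v (T w)) : HasSpacelikeEigenpair g T := by
  have := hg.finiteDimensional
  have step (B : Submodule ℝ V) (hB : IsInvariantSubspace T B) (hBd : 1 ≤ Module.finrank ℝ B) :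
      HasSpacelikeEigenpair g T ∨ ∃ f ∈ B, IsSpacelikeEigenvector g T f := by
    obtain ⟨u, huB, hu0, ⟨l, hl⟩ | ⟨a, d, w, hd, hwB, hu, hw⟩⟩ :=
      exists_eigenvector_or_quadratic_mod (isInvariantSubspace_bot T) hB
        (not_le_of_finrank_lt (by rw [finrank_bot]; omega))
    · have hl : T u = l • u := sub_eq_zero.1 ((Submodule.mem_bot ℝ).1 hl)
      have hu0 : u ≠ 0 := by simpa using hu0
      rcases lt_trichotomy (g u u) 0 with h | h | h
      · left
        exact hg.hasSpacelikeEigenpair_of_timelike_mem hT (isInvariantSubspace_span_singleton hl)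
          ((finrank_span_singleton_le_one u).trans (by norm_num))
          (Submodule.mem_span_singleton_self u) h
      · exact Or.inl (hg.hasSpacelikeEigenpair_of_null hT ⟨⟨hu0, h⟩, l, hl⟩)
      · exact Or.inr ⟨u, huB, h, l, hl⟩
    · left
      have hw : T w = a • w - d • u := by
        rw [Submodule.mem_bot] at hw
        rw [← sub_eq_zero, ← hw]
        abel
      obtain ⟨t, htP, ht⟩ :=
        hg.exists_timelike_mem_span_of_quadratic hT (by simpa using hu0) hd hu hw
      have huP : u ∈ Submodule.span ℝ {u, w} := Submodule.subset_span (by simp)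
      have hwP : w ∈ Submodule.span ℝ {u, w} := Submodule.subset_span (by simp)
      refine hg.hasSpacelikeEigenpair_of_timelike_mem hT (isInvariantSubspace_span ?_) ?_ htP ht
      · rintro v (rfl | rfl)
        · rw [hu]; exact Submodule.add_mem _ (Submodule.smul_mem _ _ huP) hwP
        · rw [hw]
          exact Submodule.sub_mem _ (Submodule.smul_mem _ _ hwP) (Submodule.smul_mem _ _ huP)
      · have := finrank_range_le_card (R := ℝ) ![u, w]
        rw [Set.finrank, Matrix.range_cons_cons_empty, Fintype.card_fin] at this
        omega
  rcases step ⊤ (fun _ _ => Submodule.mem_top) (by rw [finrank_top, hg.finrank_eq]; norm_num)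
    with h | ⟨e, -, he⟩
  · exact h
  obtain ⟨n, hn⟩ := he.2
  have hd := finrank_le_finrank_inf_orthogonal_add_one g ⊤ e
  rw [top_inf_eq, finrank_top, hg.finrank_eq] at hd
  rcases step _ (isInvariantSubspace_orthogonal hT (isInvariantSubspace_span_singleton hn))
    (by omega) with h | ⟨f, hfB, hf⟩
  · exact h
  · exact ⟨e, f, he, hf, mem_orthogonal_span_singleton.1 hfB⟩

/-- There is an invariant space-like plane whose complement contains a time-like vector. -/
theorem IsLorentzian.exists_spacelikePlane (hg : IsLorentzian g) {T : Module.End ℝ V}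
    (hT : ∀ v w, g (T v) w = g v (T w)) :
    ∃ W : Submodule ℝ V, Module.finrank ℝ W = 2 ∧ IsSpacelikeSubspace g W ∧
      IsInvariantSubspace T W ∧ ∃ t ∈ g.orthogonal W, g t t < 0 := by
  obtain ⟨e, f, ⟨he, l, hl⟩, ⟨hf, m, hm⟩, hef⟩ := hg.hasSpacelikeEigenpair hT
  have hfe : g f e = 0 := (hg.symm f e).trans hef
  have hli : LinearIndependent ℝ ![e, f] := by
    rw [LinearIndependent.pair_iff' (by rintro rfl; simp at he)]
    rintro a rfl
    rw [map_smul, smul_eq_mul, mul_eq_zero] at hef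
    rcases hef with rfl | h
    · simp at hf
    · exact he.ne' h
  have hrank := finrank_span_pair hli
  have hsq (a b : ℝ) : g (a • e + b • f) (a • e + b • f) = a ^ 2 * g e e + b ^ 2 * g f f := by
    simp [hef, hfe]
    ring
  refine ⟨Submodule.span ℝ {e, f}, hrank, ⟨hrank.ge, ?_⟩, ?_, ?_⟩
  · rintro v hv ⟨hv0, hvn⟩
    obtain ⟨a, b, rfl⟩ := Submodule.mem_span_pair.1 hv
    rw [hsq] at hvn
    apply hv0
    have ha : a = 0 := by
      by_contra ha
      have : 0 < a ^ 2 * g e e := by positivity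
      have : 0 ≤ b ^ 2 * g f f := by positivity
      linarith
    have hb : b = 0 := by
      by_contra hb
      have : 0 < b ^ 2 * g f f := by positivity
      have : 0 ≤ a ^ 2 * g e e := by positivity
      linarith
    rw [ha, hb, zero_smul, zero_smul, add_zero]
  · apply isInvariantSubspace_span
    rintro v (rfl | rfl)
    · rw [hl]; exact Submodule.smul_mem _ _ (Submodule.subset_span (by simp))
    · rw [hm]; exact Submodule.smul_mem _ _ (Submodule.subset_span (by simp))
  · obtain ⟨t, ht⟩ := hg.exists_timelike
    -- Orthogonal projection of `t` off the plane; removing space-like components can only lower `g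
    -- t t`.
    refine ⟨t - (g e t / g e e) • e - (g f t / g f f) • f, ?_, ?_⟩
    · intro v hv
      obtain ⟨a, b, rfl⟩ := Submodule.mem_span_pair.1 hv
      simp [hef, hfe]
      field_simp
      ring
    · have : g (t - (g e t / g e e) • e - (g f t / g f f) • f)
          (t - (g e t / g e e) • e - (g f t / g f f) • f) =
          g t t - g e t ^ 2 / g e e - g f t ^ 2 / g f f := by
        simp [hef, hfe, hg.symm t e, hg.symm t f]
        field_simp
        ring
      rw [this]
      have h1 : 0 ≤ g e t ^ 2 / g e e := by positivity
      have h2 : 0 ≤ g f t ^ 2 / g f f := by positivity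
      linarith

/-- With `s ∈ W` space-like and orthogonal to `t`, the vectors `|s| t ± |t| s` are independent and
null. -/
theorem IsLorentzian.isTimelikeSubspace (hg : IsLorentzian g) {W : Submodule ℝ V}
    (hdim : 2 ≤ Module.finrank ℝ W) {t : V} (htW : t ∈ W) (ht : g t t < 0) :
    IsTimelikeSubspace g W := by
  have := hg.finiteDimensional
  have hd := finrank_le_finrank_inf_orthogonal_add_one g W t
  obtain ⟨s, hsW, hs0⟩ := (W ⊓ g.orthogonal (Submodule.span ℝ {t})).exists_mem_ne_zero_of_ne_bot
    (by intro h; rw [h, finrank_bot] at hd; omega)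
  have hts : g t s = 0 := mem_orthogonal_span_singleton.1 hsW.2
  have hst : g s t = 0 := (hg.symm s t).trans hts
  have hs := hg.pos_of_orthogonal_timelike ht hts hs0
  set a := Real.sqrt (g s s)
  set b := Real.sqrt (-g t t)
  have ha2 : a ^ 2 = g s s := Real.sq_sqrt hs.le
  have hb2 : b ^ 2 = -g t t := Real.sq_sqrt (by linarith)
  have ha : 0 < a := Real.sqrt_pos.2 hs
  have hb : 0 < b := Real.sqrt_pos.2 (by linarith)
  have hli : LinearIndependent ℝ ![a • t + b • s, a • t - b • s] := by
    rw [LinearIndependent.pair_iff]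
    intro x y hxy
    have h1 : g t (x • (a • t + b • s) + y • (a • t - b • s)) = 0 := by rw [hxy, map_zero]
    have h2 : g s (x • (a • t + b • s) + y • (a • t - b • s)) = 0 := by rw [hxy, map_zero]
    simp only [map_add, map_sub, map_smul, smul_eq_mul, hts, hst] at h1 h2
    have h3 : (x + y) * (a * g t t) = 0 := by linear_combination h1
    have h4 : (x - y) * (b * g s s) = 0 := by linear_combination h2
    have h5 := (mul_eq_zero.1 h3).resolve_right (mul_ne_zero ha.ne' ht.ne)
    have h6 := (mul_eq_zero.1 h4).resolve_right (mul_ne_zero hb.ne' hs.ne')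
    constructor <;> linarith
  refine ⟨_, W.add_mem (W.smul_mem a htW) (W.smul_mem b hsW.1), _,
    W.sub_mem (W.smul_mem a htW) (W.smul_mem b hsW.1), ⟨hli.ne_zero 0, ?_⟩,
    ⟨hli.ne_zero 1, ?_⟩, hli⟩
  all_goals
    simp [hts, hst]
    linear_combination g t t * ha2 + g s s * hb2

theorem mixedForm_isSelfAdjoint (hg : IsLorentzian g) {R : LinearMap.BilinForm ℝ V}
    (hR : R.IsSymm) (v w : V) :
    g (mixedForm g R hg v) w = g v (mixedForm g R hg w) := by
  rw [hg.symm v, mixedForm_spec, mixedForm_spec]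
  exact hR.eq v w

end Lorentzian

/-! ### Assembly in the tangent space at a point. -/

theorem theorem3 {M : Type*} [TopologicalSpace M]
    [ChartedSpace (EuclideanSpace ℝ (Fin 5)) M] [IsManifold (𝓡 5) ∞ M]
    (g : LorentzianMetric M) (p : M)
    (R : LinearMap.BilinForm ℝ (TangentSpace (𝓡 5) p)) (hR : R.IsSymm) :
    -- (i) an invariant space-like plane
    (∃ W : Submodule ℝ (TangentSpace (𝓡 5) p), Module.finrank ℝ W = 2 ∧
      IsSpacelikeSubspace (g.formAt p) W ∧ IsInvariantSubspace (g.mixed p R) W) ∧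
    -- (ii) orthogonal complements of non-null invariant subspaces
    (∀ W : Submodule ℝ (TangentSpace (𝓡 5) p), ¬ IsNullSubspace (g.formAt p) W →
      IsInvariantSubspace (g.mixed p R) W →
      IsInvariantSubspace (g.mixed p R) ((g.formAt p).orthogonal W)) ∧
    -- (iii) an invariant time-like 3-subspace
    (∃ W : Submodule ℝ (TangentSpace (𝓡 5) p), Module.finrank ℝ W = 3 ∧
      IsTimelikeSubspace (g.formAt p) W ∧ IsInvariantSubspace (g.mixed p R) W) ∧
    -- (iv) null invariant `r`-subspaces, `r = 2, 3, 4`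
    (∀ r : ℕ, r = 2 ∨ r = 3 ∨ r = 4 →
      ((∃ N : Submodule ℝ (TangentSpace (𝓡 5) p), Module.finrank ℝ N = r ∧
          IsNullSubspace (g.formAt p) N ∧ IsInvariantSubspace (g.mixed p R) N) ↔
        ∃ k, IsNullEigenvector (g.formAt p) (g.mixed p R) k) ∧
      (∀ N : Submodule ℝ (TangentSpace (𝓡 5) p), Module.finrank ℝ N = r →
        IsNullSubspace (g.formAt p) N → IsInvariantSubspace (g.mixed p R) N →
        ∃ k ∈ N, IsNullEigenvector (g.formAt p) (g.mixed p R) k) ∧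
      (∀ k, IsNullEigenvector (g.formAt p) (g.mixed p R) k →
        ∃ N : Submodule ℝ (TangentSpace (𝓡 5) p), Module.finrank ℝ N = r ∧
          IsNullSubspace (g.formAt p) N ∧ IsInvariantSubspace (g.mixed p R) N ∧ k ∈ N)) := by
  have hg : IsLorentzian (g.formAt p) := g.lorentzian p
  have hT : ∀ v w, g.formAt p (g.mixed p R v) w = g.formAt p v (g.mixed p R w) :=
    mixedForm_isSelfAdjoint hg hR
  have := hg.finiteDimensional
  obtain ⟨W, hW2, hWs, hWi, t, htW, ht⟩ := hg.exists_spacelikePlane hT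
  have hrank : Module.finrank ℝ ((g.formAt p).orthogonal W) = 3 := by
    rw [LinearMap.BilinForm.finrank_orthogonal hg.nondegenerate, hg.finrank_eq, hW2]
  refine ⟨⟨W, hW2, hWs, hWi⟩, fun U _ hU => isInvariantSubspace_orthogonal hT hU,
    ⟨_, hrank, hg.isTimelikeSubspace (by omega) htW ht, isInvariantSubspace_orthogonal hT hWi⟩,
    fun r hr => ⟨⟨?_, ?_⟩, fun N _ hN hTN => hg.exists_nullEigenvector_mem hT hN hTN,
      fun k hk => hg.exists_nullSubspace hT hk hr⟩⟩
  · rintro ⟨N, -, hN, hTN⟩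
    obtain ⟨k, -, hk⟩ := hg.exists_nullEigenvector_mem hT hN hTN
    exact ⟨k, hk⟩
  · rintro ⟨k, hk⟩
    obtain ⟨N, h1, h2, h3, -⟩ := hg.exists_nullSubspace hT hk hr
    exact ⟨N, h1, h2, h3⟩
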